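/- For a $C^*$-algebra $A$ and $a,b\in A$, write $a\perp\!\!\!\perp^S b$ (mutual strong Birkhoff–James orthogonality) if $\|a+bc\|\ge\|a\|$ and $\|b+ac\|\ge\|b\|$ for every $c\in A$. This relation does not change when $a$ and $b$ are multiplied by nonzero scalars. The orthograph $\Gamma(A)$ is the graph whose vertices are the nonzero elements of $A$ up to nonzero complex scalar multiples, two vertices $[a]$, $[b]$ being adjacent if and only if $a\perp\!\!\!\perp^S b$. The distance of two vertices in the same connected component of a graph is the least number of edges of a path between them, and the diameter of a (possibly disconnected) graph is the supremum of the distances over all pairs of vertices that lie in the same connected component. Let $m\ge 1$ and let $n_1,\dots,n_m\ge 1$ be integers, all different from $2$ and $3$. Let $A=M_{n_1}(\mathbb C)\oplus M_{n_2}(\mathbb C)\oplus\dots\oplus M_{n_m}(\mathbb C)$ be the direct sum $C^*$-algebra (with the maximum of the operator norms of the components as its norm). Then the diameter of the orthograph $\Gamma(A)$ is at most $3$. -/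

import Mathlib

open scoped Matrix.Norms.L2Operator LinearAlgebra.Projectivization

/-- Strong Birkhoff-James orthogonality in a C⋆-algebra: `‖a + b c‖ ≥ ‖a‖` for every `c`. -/
def StrongBJ {A : Type*} [NonUnitalCStarAlgebra A] (a b : A) : Prop :=
  ∀ c : A, ‖a‖ ≤ ‖a + b * c‖

/-- Mutual strong Birkhoff-James orthogonality. -/
def MutualStrongBJ {A : Type*} [NonUnitalCStarAlgebra A] (a b : A) : Prop :=
  StrongBJ a b ∧ StrongBJ b a

theorem MutualStrongBJ.symm {A : Type*} [NonUnitalCStarAlgebra A] {a b : A}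
    (h : MutualStrongBJ a b) : MutualStrongBJ b a :=
  ⟨h.2, h.1⟩

theorem StrongBJ.smul {A : Type*} [NonUnitalCStarAlgebra A] {a b : A}
    (h : StrongBJ a b) {s : ℂ} (hs : s ≠ 0) (t : ℂ) : StrongBJ (s • a) (t • b) := by
  intro c
  have e : s • a + t • b * c = s • (a + b * (s⁻¹ • t • c)) := by
    rw [smul_add, mul_smul_comm, smul_smul, mul_inv_cancel₀ hs, one_smul, mul_smul_comm,
      smul_mul_assoc]
  rw [e, norm_smul, norm_smul]
  exact mul_le_mul_of_nonneg_left (h _) (norm_nonneg s)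

theorem MutualStrongBJ.smul {A : Type*} [NonUnitalCStarAlgebra A] {a b : A}
    (h : MutualStrongBJ a b) {s t : ℂ} (hs : s ≠ 0) (ht : t ≠ 0) :
    MutualStrongBJ (s • a) (t • b) :=
  ⟨h.1.smul hs t, h.2.smul ht s⟩

/-- A nonzero element is never strongly orthogonal to itself, so the orthograph has no loops. -/
theorem not_strongBJ_self {A : Type*} [NonUnitalCStarAlgebra A] {a : A} (ha : a ≠ 0) :
    ¬ StrongBJ a a := by
  intro h
  let _ : PartialOrder A := CStarAlgebra.spectralOrder A
  have : StarOrderedRing A := CStarAlgebra.spectralOrderedRing A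
  have hl := CStarAlgebra.increasingApproximateUnit A
  have := hl.neBot
  have ht : Filter.Tendsto (fun e : A => ‖a + a * (-e)‖) (CStarAlgebra.approximateUnit A)
      (nhds ‖a + -a‖) := by
    have := (hl.tendsto_mul_left a).neg.const_add a
    simpa only [mul_neg] using this.norm
  have h0 : ‖a‖ ≤ ‖a + -a‖ := ge_of_tendsto' ht (fun e => h (-e))
  rw [add_neg_cancel, norm_zero] at h0
  exact ha (norm_le_zero_iff.mp h0)

/-- The orthograph of a C⋆-algebra: its vertices are the points of the projective space of `A`
(nonzero elements up to nonzero scalars), its edges the mutually strongly orthogonal pairs. The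
choice of representatives does not matter, see `orthograph_adj_mk`. -/
def orthograph (A : Type*) [NonUnitalCStarAlgebra A] : SimpleGraph (ℙ ℂ A) where
  Adj u v := MutualStrongBJ u.rep v.rep
  symm := ⟨fun _ _ h => h.symm⟩
  loopless := ⟨fun u h => not_strongBJ_self u.rep_nonzero h.1⟩

theorem orthograph_adj_mk {A : Type*} [NonUnitalCStarAlgebra A] {a b : A}
    (ha : a ≠ 0) (hb : b ≠ 0) :
    (orthograph A).Adj (Projectivization.mk ℂ a ha) (Projectivization.mk ℂ b hb) ↔
      MutualStrongBJ a b := by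
  obtain ⟨s, hs⟩ := Projectivization.exists_smul_eq_mk_rep ℂ a ha
  obtain ⟨t, ht⟩ := Projectivization.exists_smul_eq_mk_rep ℂ b hb
  change MutualStrongBJ _ _ ↔ _
  rw [← hs, ← ht]
  refine ⟨fun h => ?_, fun h => h.smul s.ne_zero t.ne_zero⟩
  have := h.smul (s⁻¹).ne_zero (t⁻¹).ne_zero
  simpa only [← Units.smul_def, inv_smul_smul] using this

/-- The diameter of a possibly disconnected graph: the supremum, in `ℕ∞`, of the distances
between two vertices that lie in the same connected component. -/
noncomputable def componentDiam {V : Type*} (G : SimpleGraph V) : ℕ∞ :=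
  ⨆ (u : V) (v : V) (_ : G.Reachable u v), G.edist u v

/-- The C⋆-algebra `M_{n 0}(ℂ) ⊕ ⋯ ⊕ M_{n (m-1)}(ℂ)`: componentwise operations, and the norm is the
maximum of the operator norms of the components. -/
abbrev MatrixSum {m : ℕ} (n : Fin m → ℕ) : Type :=
  (j : Fin m) → Matrix (Fin (n j)) (Fin (n j)) ℂ

open scoped InnerProductSpace

/-! Vectors certify orthogonality: `StrongBJ a b` holds if some nonzero `x` is top singular for `a`
and killed by `b⋆`. Every nonzero `a` has a top singular `x`, every noninvertible `a` a nonzero `y`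
in the kernel of `a⋆`, and then `x ⊥ y`. Invertible elements are isolated vertices, so let `a`, `b`
be noninvertible, with vectors `x, y` and `x', y'`. Let `c`, `d` be the projections onto the
complements of `{x, q}` and `{x', p}`. Then `a – c – d – b` is a path as soon as `p ⊥ x, y', q` and
`q ⊥ y, x'`.

A block of dimension at least 4 has room for such `p`, `q`. Otherwise, 2 and 3 being excluded, every
block has dimension 1 and comparing the indices of the blocks suffices. -/

/-- The Hilbert spaces on which the summands of `MatrixSum n` act. -/
abbrev BlockVec {m : ℕ} (n : Fin m → ℕ) : Type :=
  (j : Fin m) → EuclideanSpace ℂ (Fin (n j))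

/-- The operator by which the `j`-th component of `a` acts. -/
noncomputable abbrev blockOp {m : ℕ} {n : Fin m → ℕ} (a : MatrixSum n) (j : Fin m) :
    EuclideanSpace ℂ (Fin (n j)) →L[ℂ] EuclideanSpace ℂ (Fin (n j)) :=
  Matrix.toEuclideanCLM (𝕜 := ℂ) (a j)

/-- `x` lies in the eigenspace of `a a⋆` for the largest possible eigenvalue `‖a‖²`. -/
def IsTopSingular {m : ℕ} {n : Fin m → ℕ} (a : MatrixSum n) (x : BlockVec n) : Prop :=
  ∀ j, blockOp a j (star (blockOp a j) (x j)) = ((‖a‖ : ℂ) ^ 2) • x j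

/-- `x` lies in the kernel of `a⋆`, the orthogonal complement of the range of `a`. -/
def IsCokernelVec {m : ℕ} {n : Fin m → ℕ} (a : MatrixSum n) (x : BlockVec n) : Prop :=
  ∀ j, star (blockOp a j) (x j) = 0

/-- Orthogonality in every summand. -/
def BlockOrth {m : ℕ} {n : Fin m → ℕ} (x y : BlockVec n) : Prop :=
  ∀ j, ⟪x j, y j⟫_ℂ = 0

section

variable {m : ℕ} {n : Fin m → ℕ}

theorem BlockOrth.symm {x y : BlockVec n} (h : BlockOrth x y) : BlockOrth y x :=
  fun j => inner_eq_zero_symm.mp (h j)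

theorem BlockOrth.single_iff {i : Fin m} {v w : EuclideanSpace ℂ (Fin (n i))} :
    BlockOrth (n := n) (Pi.single i v) (Pi.single i w) ↔ ⟪v, w⟫_ℂ = 0 := by
  refine ⟨fun h => by simpa using h i, fun h j => ?_⟩
  rcases eq_or_ne j i with rfl | hj
  · simpa using h
  · simp [hj]

theorem BlockOrth.single_of_ne {i k : Fin m} (hik : i ≠ k) (v : EuclideanSpace ℂ (Fin (n i)))
    (w : EuclideanSpace ℂ (Fin (n k))) :
    BlockOrth (n := n) (Pi.single i v) (Pi.single k w) := by
  intro j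
  rcases eq_or_ne j i with rfl | hj
  · simp [hik]
  · simp [hj]

theorem norm_blockOp_le (a : MatrixSum n) (j : Fin m) : ‖blockOp a j‖ ≤ ‖a‖ :=
  norm_le_pi_norm a j

theorem inner_star_apply {E : Type*} [NormedAddCommGroup E] [InnerProductSpace ℂ E]
    [CompleteSpace E] (T : E →L[ℂ] E) (x y : E) : ⟪star T x, y⟫_ℂ = ⟪x, T y⟫_ℂ := by
  rw [ContinuousLinearMap.star_eq_adjoint, ContinuousLinearMap.adjoint_inner_left]

theorem star_add_mul_apply {E : Type*} [NormedAddCommGroup E] [InnerProductSpace ℂ E]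
    [CompleteSpace E] (S T R : E →L[ℂ] E) (x : E) :
    star (S + T * R) x = star S x + star R (star T x) := by
  rw [star_add, star_mul]
  rfl

theorem norm_star_clm {E : Type*} [NormedAddCommGroup E] [InnerProductSpace ℂ E]
    [CompleteSpace E] (T : E →L[ℂ] E) : ‖star T‖ = ‖T‖ :=
  norm_star T

theorem norm_mul_star_self {E : Type*} [NormedAddCommGroup E] [InnerProductSpace ℂ E]
    [CompleteSpace E] (T : E →L[ℂ] E) : ‖T * star T‖ = ‖T‖ ^ 2 := by
  rw [CStarRing.norm_self_mul_star, sq]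

theorem IsTopSingular.norm_eq {a : MatrixSum n} {x : BlockVec n} (h : IsTopSingular a x) (j : Fin m) :
    ‖star (blockOp a j) (x j)‖ = ‖a‖ * ‖x j‖ := by
  have h1 : ⟪star (blockOp a j) (x j), star (blockOp a j) (x j)⟫_ℂ
      = (‖a‖ : ℂ) ^ 2 * ⟪x j, x j⟫_ℂ := by
    rw [inner_star_apply, h j, inner_smul_right]
  rw [inner_self_eq_norm_sq_to_K, inner_self_eq_norm_sq_to_K] at h1
  have h2 : ‖star (blockOp a j) (x j)‖ ^ 2 = (‖a‖ * ‖x j‖) ^ 2 := by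
    rw [mul_pow]
    refine Complex.ofReal_injective ?_
    push_cast
    exact h1
  exact (sq_eq_sq₀ (norm_nonneg _) (by positivity)).mp h2

/-- As `‖a‖ ≠ 0`, the eigenvector equation puts `x` in the range of `a`. -/
theorem IsTopSingular.blockOrth {a : MatrixSum n} (ha : a ≠ 0) {x y : BlockVec n} (hx : IsTopSingular a x)
    (hy : IsCokernelVec a y) : BlockOrth x y := by
  intro j
  have h1 : ⟪((‖a‖ : ℂ) ^ 2) • x j, y j⟫_ℂ = 0 := by
    rw [← hx j, ← ContinuousLinearMap.adjoint_inner_right,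
      ← ContinuousLinearMap.star_eq_adjoint, hy j, inner_zero_right]
  rw [inner_smul_left, mul_eq_zero] at h1
  refine h1.resolve_left ?_
  simpa using ha

/-- At `x` the adjoint of `a + b c` agrees with `a⋆`, which already stretches `x` by `‖a‖`. -/
theorem IsTopSingular.strongBJ {a b : MatrixSum n} {x : BlockVec n} (hx0 : x ≠ 0) (hx : IsTopSingular a x)
    (hb : IsCokernelVec b x) : StrongBJ a b := by
  intro c
  obtain ⟨j, hj⟩ := Function.ne_iff.mp hx0
  have h1 : star (blockOp (a + b * c) j) (x j) = star (blockOp a j) (x j) := by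
    have : blockOp (a + b * c) j = blockOp a j + blockOp b j * blockOp c j := by
      simp [blockOp]
    rw [this, star_add_mul_apply, hb j, map_zero, add_zero]
  have h2 := (star (blockOp (a + b * c) j)).le_opNorm (x j)
  rw [h1, hx.norm_eq j, norm_star_clm] at h2
  exact (le_of_mul_le_mul_right h2 (norm_pos_iff.mpr hj)).trans (norm_blockOp_le _ _)

/-! ### Existence of the certifying vectors -/

theorem exists_isTopSingular {a : MatrixSum n} (ha : a ≠ 0) :
    ∃ (i : Fin m) (v : EuclideanSpace ℂ (Fin (n i))), v ≠ 0 ∧ IsTopSingular a (Pi.single i v) := by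
  obtain ⟨i0, -⟩ := Function.ne_iff.mp ha
  have : Nonempty (Fin m) := ⟨i0⟩
  obtain ⟨i, hi⟩ : ∃ i, ‖a i‖ = ‖a‖ := by
    obtain ⟨i, -, hi⟩ := Finset.exists_mem_eq_sup Finset.univ Finset.univ_nonempty (fun i => ‖a i‖₊)
    exact ⟨i, by rw [Pi.norm_def, hi]; rfl⟩
  set T := blockOp a i with hT
  have hTn : ‖T‖ = ‖a‖ := hi
  have hT0 : T ≠ 0 := by
    rw [← norm_pos_iff, hTn]; exact norm_pos_iff.mpr ha
  have : Nontrivial (EuclideanSpace ℂ (Fin (n i)) →L[ℂ] EuclideanSpace ℂ (Fin (n i))) :=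
    ⟨T, 0, hT0⟩
  obtain ⟨k, hk, hkn⟩ := spectrum.exists_nnnorm_eq_spectralRadius (T * star T)
  rw [(IsSelfAdjoint.mul_star_self T).spectralRadius_eq_nnnorm] at hkn
  have hkn : ‖k‖ = ‖a‖ ^ 2 := by
    have h1 : ‖k‖₊ = ‖T * star T‖₊ := by exact_mod_cast hkn
    have h2 : ‖k‖ = ‖T * star T‖ := congrArg NNReal.toReal h1
    rw [h2, norm_mul_star_self, hTn]
  have hk' : Module.End.HasEigenvalue ((T * star T : EuclideanSpace ℂ (Fin (n i)) →L[ℂ] _) :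
      Module.End ℂ (EuclideanSpace ℂ (Fin (n i)))) k := by
    rw [Module.End.hasEigenvalue_iff_mem_spectrum]
    have := (AlgEquiv.spectrum_eq (Module.End.toContinuousLinearMap
      (EuclideanSpace ℂ (Fin (n i)))).symm (T * star T))
    rw [← this] at hk
    exact hk
  obtain ⟨v, hv⟩ := hk'.exists_hasEigenvector
  have hv1 : T (star T v) = k • v := hv.apply_eq_smul
  -- So far only the modulus of `k` is known; as a Rayleigh quotient of `T T⋆` it is real and
  -- nonnegative.
  have hkk : k = (‖a‖ : ℂ) ^ 2 := by
    have h1 : ⟪star T v, star T v⟫_ℂ = k * ⟪v, v⟫_ℂ := by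
      rw [inner_star_apply, hv1, inner_smul_right]
    rw [inner_self_eq_norm_sq_to_K, inner_self_eq_norm_sq_to_K] at h1
    have hv0 : ‖v‖ ≠ 0 := norm_ne_zero_iff.mpr hv.2
    have h2 : k = ((‖star T v‖ ^ 2 / ‖v‖ ^ 2 : ℝ) : ℂ) := by
      push_cast
      rw [eq_div_iff (by exact_mod_cast pow_ne_zero 2 hv0)]
      exact h1.symm
    have h3 : ‖k‖ = ‖star T v‖ ^ 2 / ‖v‖ ^ 2 := by
      rw [h2, Complex.norm_real, Real.norm_of_nonneg (by positivity)]
    rw [h2, ← h3, hkn]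
    push_cast
    rfl
  refine ⟨i, v, hv.2, fun j => ?_⟩
  rcases eq_or_ne j i with rfl | hj
  · simpa [← hkk] using hv1
  · simp [hj]

theorem exists_isCokernelVec {a : MatrixSum n} (ha : ¬ IsUnit a) :
    ∃ (k : Fin m) (w : EuclideanSpace ℂ (Fin (n k))), w ≠ 0 ∧ IsCokernelVec a (Pi.single k w) := by
  rw [Pi.isUnit_iff] at ha
  push Not at ha
  obtain ⟨k, hk⟩ := ha
  have hdet : (star (a k)).det = 0 := by
    rw [Matrix.isUnit_iff_isUnit_det, isUnit_iff_ne_zero, not_not] at hk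
    rw [Matrix.star_eq_conjTranspose, Matrix.det_conjTranspose, hk, star_zero]
  obtain ⟨w, hw0, hw⟩ := Matrix.exists_mulVec_eq_zero_iff.mpr hdet
  refine ⟨k, WithLp.toLp 2 w, by simpa using hw0, fun j => ?_⟩
  rcases eq_or_ne j k with rfl | hj
  · rw [blockOp, ← map_star, Pi.single_eq_same, Matrix.toEuclideanCLM_toLp, hw, WithLp.toLp_zero]
  · simp [hj]

/-- For invertible `b`, the choice `c = -b⁻¹ a` cancels `a`. -/
theorem not_isUnit_of_strongBJ {a b : MatrixSum n} (ha : a ≠ 0) (h : StrongBJ a b) :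
    ¬ IsUnit b := by
  rintro ⟨u, rfl⟩
  have := h (-((↑u⁻¹ : MatrixSum n) * a))
  rw [mul_neg, Units.mul_inv_cancel_left, add_neg_cancel, norm_zero] at this
  exact ha (norm_le_zero_iff.mp this)

/-! ### Paths through projections -/

/-- There is an element whose cokernel contains `x` and `q` and which is extremal on everything
orthogonal to them: a projection. -/
theorem exists_isCokernelVec_isTopSingular (x q : BlockVec n)
    (hz : ∃ z : BlockVec n, z ≠ 0 ∧ BlockOrth x z ∧ BlockOrth q z) :
    ∃ c : MatrixSum n, c ≠ 0 ∧ IsCokernelVec c x ∧ IsCokernelVec c q ∧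
      ∀ z, BlockOrth x z → BlockOrth q z → IsTopSingular c z := by
  let K : (j : Fin m) → Submodule ℂ (EuclideanSpace ℂ (Fin (n j))) :=
    fun j => Submodule.span ℂ {x j, q j}
  let c : MatrixSum n := fun j => (Matrix.toEuclideanCLM (𝕜 := ℂ)).symm (K j)ᗮ.starProjection
  have hc : ∀ j, blockOp c j = (K j)ᗮ.starProjection := fun j => by simp [blockOp, c]
  have hsa : ∀ j, star (blockOp c j) = blockOp c j := fun j => by
    rw [hc]; exact isSelfAdjoint_starProjection _
  have hfix : ∀ z, BlockOrth x z → BlockOrth q z → ∀ j, blockOp c j (z j) = z j := by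
    intro z hxz hqz j
    rw [hc, Submodule.starProjection_eq_self_iff, Submodule.mem_orthogonal]
    intro u hu
    obtain ⟨s, t, rfl⟩ := Submodule.mem_span_pair.mp hu
    rw [inner_add_left, inner_smul_left, inner_smul_left, hxz j, hqz j]
    simp
  have hker : ∀ j, ∀ u ∈ K j, star (blockOp c j) u = 0 := by
    intro j u hu
    rw [hsa, hc, Submodule.starProjection_orthogonal_val,
      Submodule.starProjection_eq_self_iff.mpr hu, sub_self]
  have hnorm : ‖c‖ = 1 := by
    refine le_antisymm ((pi_norm_le_iff_of_nonneg zero_le_one).mpr fun j => ?_) ?_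
    · change ‖blockOp c j‖ ≤ 1
      rw [hc]
      exact Submodule.starProjection_norm_le _
    · obtain ⟨z, hz0, hxz, hqz⟩ := hz
      obtain ⟨j, hj⟩ := Function.ne_iff.mp hz0
      have h1 := (blockOp c j).le_opNorm (z j)
      rw [hfix z hxz hqz j] at h1
      have h2 : (1 : ℝ) ≤ ‖blockOp c j‖ :=
        le_of_mul_le_mul_right (by simpa using h1) (norm_pos_iff.mpr hj)
      exact h2.trans (norm_blockOp_le c j)
  refine ⟨c, ?_, fun j => hker j _ (Submodule.subset_span (by simp)),
    fun j => hker j _ (Submodule.subset_span (by simp)), fun z hxz hqz j => ?_⟩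
  · rintro h
    rw [h, norm_zero] at hnorm
    exact zero_ne_one hnorm
  · rw [hsa, hfix z hxz hqz j, hfix z hxz hqz j, hnorm]
    simp

theorem exists_ne_zero_orthogonal {E : Type*} [NormedAddCommGroup E] [InnerProductSpace ℂ E]
    [FiniteDimensional ℂ E] (f : Fin 3 → E) (h : 3 < Module.finrank ℂ E) :
    ∃ p : E, p ≠ 0 ∧ ∀ i, ⟪f i, p⟫_ℂ = 0 := by
  have h1 : Submodule.span ℂ (Set.range f) ≠ ⊤ := by
    intro h2
    have h3 := finrank_range_le_card (R := ℂ) f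
    rw [Set.finrank, h2, finrank_top, Fintype.card_fin] at h3
    omega
  obtain ⟨p, hp, hp0⟩ := Submodule.exists_mem_ne_zero_of_ne_bot
    (mt (Submodule.orthogonal_eq_bot_iff).mp h1)
  exact ⟨p, hp0, fun i => (Submodule.mem_orthogonal _ _).mp hp _ (Submodule.subset_span ⟨i, rfl⟩)⟩

/-- The vectors `p` and `q` certify the middle edge: `c` fixes `p` and kills `q`, `d` the reverse.
-/
theorem exists_adj_adj_of_orthogonal {a b : MatrixSum n} {x y x' y' p q : BlockVec n}
    (hx0 : x ≠ 0) (hy0 : y ≠ 0) (hx0' : x' ≠ 0) (hy0' : y' ≠ 0) (hp0 : p ≠ 0) (hq0 : q ≠ 0)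
    (hx : IsTopSingular a x) (hy : IsCokernelVec a y) (hx' : IsTopSingular b x') (hy' : IsCokernelVec b y')
    (hxy : BlockOrth x y) (hxy' : BlockOrth x' y') (hxp : BlockOrth x p) (hyp : BlockOrth y' p)
    (hpq : BlockOrth p q) (hyq : BlockOrth y q) (hxq : BlockOrth x' q) :
    ∃ c d : MatrixSum n, c ≠ 0 ∧ d ≠ 0 ∧ MutualStrongBJ a c ∧ MutualStrongBJ c d ∧
      MutualStrongBJ d b := by
  obtain ⟨c, hc0, hcx, hcq, hc⟩ := exists_isCokernelVec_isTopSingular x q ⟨p, hp0, hxp, hpq.symm⟩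
  obtain ⟨d, hd0, hdx, hdp, hd⟩ := exists_isCokernelVec_isTopSingular x' p ⟨q, hq0, hxq, hpq⟩
  exact ⟨c, d, hc0, hd0, ⟨hx.strongBJ hx0 hcx, (hc y hxy hyq.symm).strongBJ hy0 hy⟩,
    ⟨(hc p hxp hpq.symm).strongBJ hp0 hdp, (hd q hxq hpq).strongBJ hq0 hcq⟩,
    ⟨(hd y' hxy' hyp.symm).strongBJ hy0' hy', hx'.strongBJ hx0' hdx⟩⟩

theorem exists_adj_of_orthogonal {a b : MatrixSum n} {x y x' y' : BlockVec n}
    (hx0 : x ≠ 0) (hy0 : y ≠ 0) (hx0' : x' ≠ 0) (hy0' : y' ≠ 0)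
    (hx : IsTopSingular a x) (hy : IsCokernelVec a y) (hx' : IsTopSingular b x') (hy' : IsCokernelVec b y')
    (hxy : BlockOrth x y) (hxy' : BlockOrth x' y') (h : BlockOrth x y') (h' : BlockOrth x' y) :
    ∃ c : MatrixSum n, c ≠ 0 ∧ MutualStrongBJ a c ∧ MutualStrongBJ c b := by
  obtain ⟨c, hc0, hcx, hcx', hc⟩ := exists_isCokernelVec_isTopSingular x x' ⟨y, hy0, hxy, h'⟩
  exact ⟨c, hc0, ⟨hx.strongBJ hx0 hcx, (hc y hxy h').strongBJ hy0 hy⟩,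
    ⟨(hc y' h hxy').strongBJ hy0' hy', hx'.strongBJ hx0' hcx'⟩⟩

theorem IsCokernelVec.single_of_card_eq_one {b : MatrixSum n} {i : Fin m} (hi : n i = 1)
    {v w : EuclideanSpace ℂ (Fin (n i))} (hw0 : w ≠ 0) (hw : IsCokernelVec b (Pi.single i w)) :
    IsCokernelVec b (Pi.single i v) := by
  obtain ⟨s, rfl⟩ := (finrank_eq_one_iff_of_nonzero' w hw0).mp
    (by rw [finrank_euclideanSpace_fin, hi]) v
  intro j
  rw [Pi.single_smul, Pi.smul_apply, map_smul, hw j, smul_zero]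

/-! ### The distance bound -/

theorem edist_orthograph_le (hpos : ∀ j, 1 ≤ n j) (hn : ∀ j, n j ≠ 2 ∧ n j ≠ 3)
    {a b : MatrixSum n} (ha0 : a ≠ 0) (hb0 : b ≠ 0) (ha : ¬ IsUnit a) (hb : ¬ IsUnit b) :
    (orthograph (MatrixSum n)).edist (Projectivization.mk ℂ a ha0) (Projectivization.mk ℂ b hb0)
      ≤ 3 := by
  obtain ⟨i, x, hx0, hx⟩ := exists_isTopSingular ha0
  obtain ⟨k, y, hy0, hy⟩ := exists_isCokernelVec ha
  obtain ⟨i', x', hx0', hx'⟩ := exists_isTopSingular hb0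
  obtain ⟨k', y', hy0', hy'⟩ := exists_isCokernelVec hb
  have hxy := hx.blockOrth ha0 hy
  have hxy' := hx'.blockOrth hb0 hy'
  have hX0 : (Pi.single i x : BlockVec n) ≠ 0 := by simpa using hx0
  have hY0 : (Pi.single k y : BlockVec n) ≠ 0 := by simpa using hy0
  have hX0' : (Pi.single i' x' : BlockVec n) ≠ 0 := by simpa using hx0'
  have hY0' : (Pi.single k' y' : BlockVec n) ≠ 0 := by simpa using hy0'
  have three : ∀ {p q : BlockVec n}, p ≠ 0 → q ≠ 0 → BlockOrth (Pi.single i x) p →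
      BlockOrth (Pi.single k' y') p → BlockOrth p q → BlockOrth (Pi.single k y) q →
      BlockOrth (Pi.single i' x') q → (orthograph (MatrixSum n)).edist
        (Projectivization.mk ℂ a ha0) (Projectivization.mk ℂ b hb0) ≤ 3 := by
    intro p q hp0 hq0 h1 h2 h3 h4 h5
    obtain ⟨c, d, hc0, hd0, hac, hcd, hdb⟩ := exists_adj_adj_of_orthogonal hX0 hY0 hX0' hY0'
      hp0 hq0 hx hy hx' hy' hxy hxy' h1 h2 h3 h4 h5
    exact SimpleGraph.Walk.edist_le (.cons ((orthograph_adj_mk ha0 hc0).mpr hac)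
      (.cons ((orthograph_adj_mk hc0 hd0).mpr hcd) (.cons ((orthograph_adj_mk hd0 hb0).mpr hdb)
        .nil)))
  by_cases hbig : ∃ j, 3 < n j
  · obtain ⟨j, hj⟩ := hbig
    have hdim : 3 < Module.finrank ℂ (EuclideanSpace ℂ (Fin (n j))) := by
      rwa [finrank_euclideanSpace_fin]
    have orth : ∀ {z : BlockVec n} {v : EuclideanSpace ℂ (Fin (n j))}, ⟪z j, v⟫_ℂ = 0 →
        BlockOrth z (Pi.single j v) := by
      intro z v h l
      rcases eq_or_ne l j with rfl | hl
      · simpa using h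
      · simp [hl]
    -- `q` has two constraints, padded by `0`; `p` has three, since it must also avoid `q`. Hence
    -- dimension 4.
    obtain ⟨q, hq0, hq⟩ := exists_ne_zero_orthogonal
      ![(Pi.single k y : BlockVec n) j, (Pi.single i' x' : BlockVec n) j, 0] hdim
    obtain ⟨p, hp0, hp⟩ := exists_ne_zero_orthogonal
      ![(Pi.single i x : BlockVec n) j, (Pi.single k' y' : BlockVec n) j, q] hdim
    exact three (p := Pi.single j p) (q := Pi.single j q) (by simpa using hp0) (by simpa using hq0)
      (orth (hp 0)) (orth (hp 1)) (BlockOrth.symm (BlockOrth.single_iff.mpr (hp 2)))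
      (orth (hq 0)) (orth (hq 1))
  · have hone : ∀ j, n j = 1 := by
      intro j
      have h1 := hpos j
      have h2 := hn j
      have h3 : ¬ 3 < n j := fun h => hbig ⟨j, h⟩
      omega
    have ne_of_orth : ∀ {s t : Fin m} {v : EuclideanSpace ℂ (Fin (n s))}
        {w : EuclideanSpace ℂ (Fin (n t))}, v ≠ 0 → w ≠ 0 →
        BlockOrth (n := n) (Pi.single s v) (Pi.single t w) → s ≠ t := by
      rintro s _ v w hv hw h rfl
      obtain ⟨r, rfl⟩ := (finrank_eq_one_iff_of_nonzero' v hv).mp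
        (by rw [finrank_euclideanSpace_fin, hone s]) w
      rw [BlockOrth.single_iff, inner_smul_right, mul_eq_zero, inner_self_eq_zero] at h
      rcases h with rfl | h
      · exact hw (zero_smul ℂ v)
      · exact hv h
    have hik := ne_of_orth hx0 hy0 hxy
    have hik' := ne_of_orth hx0' hy0' hxy'
    by_cases h1 : i = k'
    · by_cases h2 : i' = k
      · subst h1 h2
        have hab : MutualStrongBJ a b :=
          ⟨hx.strongBJ hX0 (hy'.single_of_card_eq_one (hone _) hy0'),
            hx'.strongBJ hX0' (hy.single_of_card_eq_one (hone _) hy0)⟩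
        exact (SimpleGraph.Walk.edist_le
          (.cons ((orthograph_adj_mk ha0 hb0).mpr hab) .nil)).trans (by norm_num)
      -- Here `p = y`, `q = x`: both `x'` and `y` lie outside the common block of `x` and `y'`.
      · exact three hY0 hX0 hxy (.single_of_ne (fun h => hik (h1.trans h)) _ _) hxy.symm hxy.symm
          (.single_of_ne (fun h => hik' (h.trans h1)) _ _)
    · by_cases h2 : i' = k
      · exact three hY0 hX0 hxy (.single_of_ne (fun h => hik' (h2.trans h.symm)) _ _) hxy.symm
          hxy.symm (.single_of_ne (fun h => hik (h.symm.trans h2)) _ _)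
      · obtain ⟨c, hc0, hac, hcb⟩ := exists_adj_of_orthogonal hX0 hY0 hX0' hY0' hx hy hx' hy'
          hxy hxy' (.single_of_ne h1 _ _) (.single_of_ne h2 _ _)
        exact (SimpleGraph.Walk.edist_le (.cons ((orthograph_adj_mk ha0 hc0).mpr hac)
          (.cons ((orthograph_adj_mk hc0 hb0).mpr hcb) .nil))).trans (by norm_num)

theorem not_isUnit_rep_of_adj {u v : ℙ ℂ (MatrixSum n)}
    (h : (orthograph (MatrixSum n)).Adj u v) : ¬ IsUnit u.rep :=
  not_isUnit_of_strongBJ v.rep_nonzero h.2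

end

theorem corollary5p7 (m : ℕ) (n : Fin m → ℕ) (hpos : ∀ j, 1 ≤ n j)
    (hn : ∀ j, n j ≠ 2 ∧ n j ≠ 3) :
    componentDiam (orthograph (MatrixSum n)) ≤ 3 := by
  refine iSup_le fun u => iSup_le fun v => iSup_le fun huv => ?_
  rcases eq_or_ne u v with rfl | hne
  · simp
  · have unit : ∀ {s t : ℙ ℂ (MatrixSum n)}, (orthograph (MatrixSum n)).Reachable s t → s ≠ t →
        ¬ IsUnit s.rep := by
      rintro s t ⟨w⟩ hst
      cases w with
      | nil => exact absurd rfl hst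
      | cons h _ => exact not_isUnit_rep_of_adj h
    have := edist_orthograph_le hpos hn u.rep_nonzero v.rep_nonzero (unit huv hne)
      (unit huv.symm hne.symm)
    rwa [Projectivization.mk_rep, Projectivization.mk_rep] at this
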